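/- Let $M$ be a smooth manifold (without boundary) of finite positive dimension. Call $M$ *hyperkähler* if it carries a smooth pseudo-Riemannian metric $g$ (of any signature) and three smooth endomorphism fields $J_1, J_2, J_3$ of $TM$ such that - $J_1^2 = J_2^2 = J_3^2 = J_1 J_2 J_3 = -1$, - $g(J_iX, J_iY) = g(X,Y)$ for all tangent vectors $X, Y$ and $i = 1,2,3$, - $\nabla J_i = 0$ for $i=1,2,3$, where $\nabla$ is the Levi-Civita connection of $g$. Then $M$ is hyperkähler if and only if it possesses three smooth real 2-forms $\omega_1, \omega_2, \omega_3$ that are non-degenerate and linearly independent at every point and satisfy both of the following conditions: - (algebraic condition) viewing each $\omega_i$ as a bundle isomorphism $TM \to T^*M$, the endomorphisms $$I_1 = \omega_3^{-1}\omega_2, \qquad I_2 = \omega_1^{-1}\omega_3, \qquad I_3 = \omega_2^{-1}\omega_1$$ of $TM$ satisfy $I_1^2 = I_2^2 = I_3^2 = -1$; - (exterior differential condition) $d\omega_1 = d\omega_2 = d\omega_3 = 0$. -/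

import Mathlib

open Bundle VectorField
open scoped Manifold ContDiff

noncomputable section

namespace Hyperkahler

/-! Throughout, `M` is a smooth manifold without boundary modelled on the real vector space `E`
(finite-dimensional in the theorem); its tangent space at `x` is `TangentSpace 𝓘(ℝ, E) x`. -/

/-- A vector field on `M` (no regularity imposed), as a section of the tangent bundle. -/
abbrev VField (E : Type*) [NormedAddCommGroup E] [NormedSpace ℝ E]
    (M : Type*) [TopologicalSpace M] [ChartedSpace E M] :=
  Π x : M, TangentSpace 𝓘(ℝ, E) x

/-- A field of bilinear forms on the tangent spaces of `M`: a section of `Hom(TM, Hom(TM, ℝ))`.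
The value of `B` on tangent vectors `v`, `w` at `x` is `B x v w`, so that `B x` is also the
linear map `v ↦ B x v ·` from the tangent space to the cotangent space at `x`. -/
abbrev BilinField (E : Type*) [NormedAddCommGroup E] [NormedSpace ℝ E]
    (M : Type*) [TopologicalSpace M] [ChartedSpace E M] :=
  Π x : M, TangentSpace 𝓘(ℝ, E) x →L[ℝ] TangentSpace 𝓘(ℝ, E) x →L[ℝ] ℝ

/-- A field of endomorphisms of the tangent spaces of `M`: a section of `End(TM)`. -/
abbrev EndField (E : Type*) [NormedAddCommGroup E] [NormedSpace ℝ E]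
    (M : Type*) [TopologicalSpace M] [ChartedSpace E M] :=
  Π x : M, TangentSpace 𝓘(ℝ, E) x →L[ℝ] TangentSpace 𝓘(ℝ, E) x

section

variable {E : Type*} [NormedAddCommGroup E] [NormedSpace ℝ E]
  {M : Type*} [TopologicalSpace M] [ChartedSpace E M] [IsManifold 𝓘(ℝ, E) ∞ M]

/-- The vector field `X` is differentiable at the point `x`. -/
def DiffAt (X : VField E M) (x : M) : Prop :=
  MDifferentiableAt 𝓘(ℝ, E) (𝓘(ℝ, E).prod 𝓘(ℝ, E))
    (fun y ↦ TotalSpace.mk' E y (X y) : M → TangentBundle 𝓘(ℝ, E) M) x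

/-- `B` is a smooth section of `Hom(TM, Hom(TM, ℝ))`. -/
def BilinField.IsSmooth (B : BilinField E M) : Prop :=
  ContMDiff 𝓘(ℝ, E) (𝓘(ℝ, E).prod 𝓘(ℝ, E →L[ℝ] E →L[ℝ] ℝ)) ∞
    (fun x ↦ TotalSpace.mk' (E →L[ℝ] E →L[ℝ] ℝ)
      (E := fun x : M ↦ TangentSpace 𝓘(ℝ, E) x →L[ℝ] TangentSpace 𝓘(ℝ, E) x →L[ℝ] ℝ) x (B x))

/-- `J` is a smooth section of `End(TM)`. -/
def EndField.IsSmooth (J : EndField E M) : Prop :=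
  ContMDiff 𝓘(ℝ, E) (𝓘(ℝ, E).prod 𝓘(ℝ, E →L[ℝ] E)) ∞
    (fun x ↦ TotalSpace.mk' (E →L[ℝ] E)
      (E := fun x : M ↦ TangentSpace 𝓘(ℝ, E) x →L[ℝ] TangentSpace 𝓘(ℝ, E) x) x (J x))

/-- `B` is non-degenerate at every point. It is used only for forms that are symmetric or
antisymmetric, for which the left and the right kernel agree. -/
def BilinField.IsNondegenerate (B : BilinField E M) : Prop :=
  ∀ (x : M) (v : TangentSpace 𝓘(ℝ, E) x), (∀ w, B x v w = 0) → v = 0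

/-- The derivative `X(f)` at `x` of a function `f` in the direction of the tangent vector `v`. -/
def dirDeriv (f : M → ℝ) (x : M) (v : TangentSpace 𝓘(ℝ, E) x) : ℝ :=
  mvfderiv 𝓘(ℝ, E) f x v

end

/-- A (smooth, real-valued) differential 2-form on `M`. -/
structure TwoForm (E : Type*) [NormedAddCommGroup E] [NormedSpace ℝ E]
    (M : Type*) [TopologicalSpace M] [ChartedSpace E M] [IsManifold 𝓘(ℝ, E) ∞ M] where
  val : BilinField E M
  alternating : ∀ (x : M) (v : TangentSpace 𝓘(ℝ, E) x), val x v v = 0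
  smooth : val.IsSmooth

/-- A (smooth) pseudo-Riemannian metric on `M`, of arbitrary signature. -/
structure PseudoRiemannianMetric (E : Type*) [NormedAddCommGroup E] [NormedSpace ℝ E]
    (M : Type*) [TopologicalSpace M] [ChartedSpace E M] [IsManifold 𝓘(ℝ, E) ∞ M] where
  val : BilinField E M
  symm : ∀ (x : M) (v w : TangentSpace 𝓘(ℝ, E) x), val x v w = val x w v
  nondegenerate : val.IsNondegenerate
  smooth : val.IsSmooth

section

variable {E : Type*} [NormedAddCommGroup E] [NormedSpace ℝ E]
  {M : Type*} [TopologicalSpace M] [ChartedSpace E M] [IsManifold 𝓘(ℝ, E) ∞ M]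

/-- The value at `x` of `dα(X, Y, Z)`, the exterior derivative of the 2-form `α` evaluated on the
vector fields `X`, `Y`, `Z`:
`X(α(Y,Z)) - Y(α(X,Z)) + Z(α(X,Y)) - α([Y,Z],X) + α([X,Z],Y) - α([X,Y],Z)`. -/
def extDerivOn (α : TwoForm E M) (X Y Z : VField E M) (x : M) : ℝ :=
  dirDeriv (fun y ↦ α.val y (Y y) (Z y)) x (X x)
    - dirDeriv (fun y ↦ α.val y (X y) (Z y)) x (Y x)
    + dirDeriv (fun y ↦ α.val y (X y) (Y y)) x (Z x)
    - α.val x (mlieBracket 𝓘(ℝ, E) Y Z x) (X x)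
    + α.val x (mlieBracket 𝓘(ℝ, E) X Z x) (Y x)
    - α.val x (mlieBracket 𝓘(ℝ, E) X Y x) (Z x)

/-- The 2-form `α` is closed, `dα = 0`. -/
def TwoForm.IsClosed (α : TwoForm E M) : Prop :=
  ∀ (x : M) (X Y Z : VField E M), DiffAt X x → DiffAt Y x → DiffAt Z x →
    extDerivOn α X Y Z x = 0

/-- The endomorphism field `β⁻¹ α` of `TM`, for `α` and `β` seen as maps `TM → T*M`; in the
theorem `β` is non-degenerate, hence pointwise invertible. It does not change if both `α` and `β`
are instead turned into maps `TM → T*M` through their second arguments. -/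
def invComp (β α : TwoForm E M) : EndField E M :=
  fun x ↦ (β.val x).inverse ∘L α.val x

/-- The connection `∇` on `TM` is the Levi-Civita connection of `g`: it is torsion-free and it
satisfies `X(g(Y, Z)) = g(∇_X Y, Z) + g(Y, ∇_X Z)`. (`cov Y x v` is `∇_v Y` at `x`.) -/
structure IsLeviCivita [FiniteDimensional ℝ E]
    (g : PseudoRiemannianMetric E M)
    (cov : CovariantDerivative 𝓘(ℝ, E) E (TangentSpace 𝓘(ℝ, E) : M → Type _)) : Prop where
  torsion_free : cov.torsion = 0
  metric : ∀ (x : M) (v : TangentSpace 𝓘(ℝ, E) x) (Y Z : VField E M), DiffAt Y x → DiffAt Z x →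
    dirDeriv (fun y ↦ g.val y (Y y) (Z y)) x v = g.val x (cov Y x v) (Z x) + g.val x (Y x) (cov Z x v)

/-- The endomorphism field `J` is parallel, `∇J = 0`: `∇_v (J Y) = J (∇_v Y)` for all `v`, `Y`. -/
def IsParallel (cov : CovariantDerivative 𝓘(ℝ, E) E (TangentSpace 𝓘(ℝ, E) : M → Type _))
    (J : EndField E M) : Prop :=
  ∀ (x : M) (v : TangentSpace 𝓘(ℝ, E) x) (Y : VField E M), DiffAt Y x →
    cov (fun y ↦ J y (Y y)) x v = J x (cov Y x v)

end

/-- A hyperkähler structure on `M`: a pseudo-Riemannian metric `g`, its Levi-Civita connection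
`∇`, and three `g`-Hermitian almost complex structures `J 0`, `J 1`, `J 2` which satisfy the
relations of the imaginary quaternions and are parallel with respect to `∇`. -/
structure HyperkahlerStructure (E : Type*) [NormedAddCommGroup E] [NormedSpace ℝ E]
    [FiniteDimensional ℝ E]
    (M : Type*) [TopologicalSpace M] [ChartedSpace E M] [IsManifold 𝓘(ℝ, E) ∞ M] where
  g : PseudoRiemannianMetric E M
  cov : CovariantDerivative 𝓘(ℝ, E) E (TangentSpace 𝓘(ℝ, E) : M → Type _)
  leviCivita : IsLeviCivita g cov
  J : Fin 3 → EndField E M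
  smooth : ∀ i, (J i).IsSmooth
  sq_eq : ∀ (i : Fin 3) (x : M) (v : TangentSpace 𝓘(ℝ, E) x), J i x (J i x v) = -v
  mul_eq : ∀ (x : M) (v : TangentSpace 𝓘(ℝ, E) x), J 0 x (J 1 x (J 2 x v)) = -v
  hermitian : ∀ (i : Fin 3) (x : M) (v w : TangentSpace 𝓘(ℝ, E) x),
    g.val x (J i x v) (J i x w) = g.val x v w
  parallel : ∀ i, IsParallel cov (J i)

/-- `M` is hyperkähler: it carries a hyperkähler structure. -/
def IsHyperkahler (E : Type*) [NormedAddCommGroup E] [NormedSpace ℝ E] [FiniteDimensional ℝ E]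
    (M : Type*) [TopologicalSpace M] [ChartedSpace E M] [IsManifold 𝓘(ℝ, E) ∞ M] : Prop :=
  Nonempty (HyperkahlerStructure E M)

end Hyperkahler

end

noncomputable section

namespace Hyperkahler

/-! ### Directional derivatives and fields differentiable at a point. -/

section Calculus

variable {E : Type*} [NormedAddCommGroup E] [NormedSpace ℝ E]
  {M : Type*} [TopologicalSpace M] [ChartedSpace E M]

/-! The dictionary between the two sides is ωᵢ = g(Jᵢ·, ·).

From a hyperkähler structure, these forms are alternating because Jᵢ is a g-isometry with square -1.
For a torsion-free metric connection, dωᵢ is a sum of terms in ∇Jᵢ, so it vanishes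
(`IsLeviCivita.extDerivOn_eq`). The quaternion relations give ω₃⁻¹ω₂ = J₁ and its cyclic analogues.

Conversely, let Jᵢ be the three endomorphisms built from the forms. The condition on their squares
already forces the quaternion relations (`IsSymplecticTriple.mul_eq`). It also makes -ωᵢ(Jᵢ·, ·)
symmetric and independent of i, which gives one metric g for which each Jᵢ is Hermitian with
fundamental form ωᵢ. The Koszul formula provides its Levi-Civita connection.

It remains to see that ∇J₁ = 0, the other cases being cyclic. The complex form Ω = ω₂ + iω₃
satisfies Ω(J₁v, w) = iΩ(v, w), so its kernel consists of the vectors X + iJ₁X. As Ω is closed, this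
kernel is involutive, that is, J₁ has vanishing Nijenhuis tensor (`nijenhuis_eq_zero`). Together
with dω₁ = 0 this makes J₁ parallel, as in Kähler geometry and in any signature
(`IsLeviCivita.isParallel`). -/

theorem dirDeriv_add {f g : M → ℝ} {x : M} (hf : MDifferentiableAt 𝓘(ℝ, E) 𝓘(ℝ, ℝ) f x)
    (hg : MDifferentiableAt 𝓘(ℝ, E) 𝓘(ℝ, ℝ) g x) (v : TangentSpace 𝓘(ℝ, E) x) :
    dirDeriv (fun y ↦ f y + g y) x v = dirDeriv f x v + dirDeriv g x v := by
  simp [dirDeriv, mvfderiv_fun_add hf hg]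

theorem dirDeriv_neg {f : M → ℝ} {x : M} (v : TangentSpace 𝓘(ℝ, E) x) :
    dirDeriv (fun y ↦ - f y) x v = - dirDeriv f x v := by
  simp [dirDeriv, mvfderiv_fun_neg]

theorem dirDeriv_mul {f g : M → ℝ} {x : M} (hf : MDifferentiableAt 𝓘(ℝ, E) 𝓘(ℝ, ℝ) f x)
    (hg : MDifferentiableAt 𝓘(ℝ, E) 𝓘(ℝ, ℝ) g x) (v : TangentSpace 𝓘(ℝ, E) x) :
    dirDeriv (fun y ↦ f y * g y) x v = f x * dirDeriv g x v + g x * dirDeriv f x v := by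
  simp [dirDeriv, mvfderiv_fun_mul hf hg]

theorem dirDeriv_vec_add {f : M → ℝ} {x : M} (v w : TangentSpace 𝓘(ℝ, E) x) :
    dirDeriv f x (v + w) = dirDeriv f x v + dirDeriv f x w :=
  map_add _ _ _

theorem dirDeriv_vec_smul {f : M → ℝ} {x : M} (c : ℝ) (v : TangentSpace 𝓘(ℝ, E) x) :
    dirDeriv f x (c • v) = c * dirDeriv f x v :=
  map_smul _ _ _

/-- The vector field `y ↦ J y (Y y)`. -/
def EndField.app (J : EndField E M) (Y : VField E M) : VField E M := fun y ↦ J y (Y y)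

theorem EndField.app_apply (J : EndField E M) (Y : VField E M) (x : M) :
    J.app Y x = J x (Y x) := rfl

variable [IsManifold 𝓘(ℝ, E) ∞ M]

theorem DiffAt.add {X Y : VField E M} {x : M} (hX : DiffAt X x) (hY : DiffAt Y x) :
    DiffAt (X + Y) x :=
  mdifferentiableAt_add_section hX hY

theorem DiffAt.smul {f : M → ℝ} {X : VField E M} {x : M}
    (hf : MDifferentiableAt 𝓘(ℝ, E) 𝓘(ℝ, ℝ) f x) (hX : DiffAt X x) : DiffAt (f • X) x :=
  MDifferentiableAt.smul_section hf hX

theorem DiffAt.app {J : EndField E M} (hJ : J.IsSmooth) {X : VField E M} {x : M}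
    (hX : DiffAt X x) : DiffAt (J.app X) x :=
  MDifferentiableAt.clm_bundle_apply (F₁ := E) (F₂ := E)
    ((hJ x).mdifferentiableAt (by simp)) hX

/-- Allows pointwise identities to be tested on fields, where brackets and derivatives make sense.
-/
theorem exists_diffAt [FiniteDimensional ℝ E] {x : M} (v : TangentSpace 𝓘(ℝ, E) x) :
    ∃ X : VField E M, DiffAt X x ∧ X x = v :=
  ⟨FiberBundle.extend E v, FiberBundle.mdifferentiableAt_extend .., by simp⟩

theorem BilinField.IsSmooth.mdifferentiableAt {B : BilinField E M} (hB : B.IsSmooth)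
    {Y Z : VField E M} {x : M} (hY : DiffAt Y x) (hZ : DiffAt Z x) :
    MDifferentiableAt 𝓘(ℝ, E) 𝓘(ℝ, ℝ) (fun y ↦ B y (Y y) (Z y)) x := by
  have : MDifferentiableAt 𝓘(ℝ, E) (𝓘(ℝ, E).prod 𝓘(ℝ))
      (fun m ↦ TotalSpace.mk' ℝ (E := Bundle.Trivial M ℝ) m (B m (Y m) (Z m))) x := by
    apply MDifferentiableAt.clm_bundle_apply₂ (F₁ := E) (F₂ := E)
    · exact (hB x).mdifferentiableAt (by simp)
    · exact hY
    · exact hZ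
  simp only [mdifferentiableAt_totalSpace] at this
  exact this.2

end Calculus

/-! ### Non-degenerate forms as isomorphisms TM → T*M. -/

section Invertible

variable {E : Type*} [NormedAddCommGroup E] [NormedSpace ℝ E] [FiniteDimensional ℝ E]
  {M : Type*} [TopologicalSpace M] [ChartedSpace E M]

theorem isInvertible_of_injective (B : E →L[ℝ] E →L[ℝ] ℝ) (hB : Function.Injective B) :
    B.IsInvertible := by
  have h : Module.finrank ℝ E = Module.finrank ℝ (E →L[ℝ] ℝ) := by
    rw [← (LinearMap.toContinuousLinearMap (𝕜 := ℝ) (E := E) (F' := ℝ)).finrank_eq]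
    exact (Subspace.dual_finrank_eq).symm
  exact ⟨(LinearEquiv.ofInjectiveOfFinrankEq B.toLinearMap hB h).toContinuousLinearEquiv, by ext; rfl⟩

theorem BilinField.IsNondegenerate.isInvertible {B : BilinField E M} (hB : B.IsNondegenerate)
    (x : M) : (B x).IsInvertible := by
  exact isInvertible_of_injective (E := E) (B x)
    ((injective_iff_map_eq_zero (B x)).2 fun v hv ↦ hB x v fun w ↦ congr($hv w))

end Invertible

/-! ### Smoothness in local frames, and smoothness of β⁻¹α. -/

section Smoothness

variable {E : Type*} [NormedAddCommGroup E] [NormedSpace ℝ E]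
  {M : Type*} [TopologicalSpace M] [ChartedSpace E M] [IsManifold 𝓘(ℝ, E) ∞ M]

/-- The coordinate expression of `B` near `x₀`. -/
def BilinField.coord (B : BilinField E M) (x₀ x : M) : E →L[ℝ] E →L[ℝ] ℝ :=
  ContinuousLinearMap.inCoordinates E (fun x : M ↦ TangentSpace 𝓘(ℝ, E) x) (E →L[ℝ] ℝ)
    (fun x : M ↦ TangentSpace 𝓘(ℝ, E) x →L[ℝ] ℝ) x₀ x x₀ x (B x)

/-- The coordinate expression of `J` near `x₀`. -/
def EndField.coord (J : EndField E M) (x₀ x : M) : E →L[ℝ] E :=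
  ContinuousLinearMap.inCoordinates E (fun x : M ↦ TangentSpace 𝓘(ℝ, E) x) E
    (fun x : M ↦ TangentSpace 𝓘(ℝ, E) x) x₀ x x₀ x (J x)

theorem BilinField.isSmooth_iff (B : BilinField E M) :
    B.IsSmooth ↔ ∀ x₀, ContMDiffAt 𝓘(ℝ, E) 𝓘(ℝ, E →L[ℝ] E →L[ℝ] ℝ) ∞ (B.coord x₀) x₀ :=
  forall_congr' fun _ ↦ (contMDiffAt_hom_bundle _).trans
    ⟨fun h ↦ h.2, fun h ↦ ⟨contMDiffAt_id, h⟩⟩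

theorem EndField.isSmooth_iff (J : EndField E M) :
    J.IsSmooth ↔ ∀ x₀, ContMDiffAt 𝓘(ℝ, E) 𝓘(ℝ, E →L[ℝ] E) ∞ (J.coord x₀) x₀ :=
  forall_congr' fun _ ↦ (contMDiffAt_hom_bundle _).trans
    ⟨fun h ↦ h.2, fun h ↦ ⟨contMDiffAt_id, h⟩⟩

/-- The frame at `x` given by the preferred trivialization at `x₀`. -/
def frameAt (x₀ x : M)
    (hx : x ∈ (trivializationAt E (TangentSpace 𝓘(ℝ, E) : M → Type _) x₀).baseSet) :
    TangentSpace 𝓘(ℝ, E) x ≃L[ℝ] E :=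
  (trivializationAt E (TangentSpace 𝓘(ℝ, E) : M → Type _) x₀).continuousLinearEquivAt ℝ x hx

theorem BilinField.coord_apply (B : BilinField E M) {x₀ x : M}
    (hx : x ∈ (trivializationAt E (TangentSpace 𝓘(ℝ, E) : M → Type _) x₀).baseSet) (a b : E) :
    B.coord x₀ x a b = B x ((frameAt x₀ x hx).symm a) ((frameAt x₀ x hx).symm b) := by
  refine Eq.trans (inCoordinates_apply_eq₂ (𝕜 := ℝ) (F₃ := ℝ) (E₃ := Bundle.Trivial M ℝ) (ϕ := B x)
    (v := a) (w := b) hx hx (by simp)) ?_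
  simp [frameAt]

theorem EndField.coord_apply (J : EndField E M) {x₀ x : M}
    (hx : x ∈ (trivializationAt E (TangentSpace 𝓘(ℝ, E) : M → Type _) x₀).baseSet) (a : E) :
    J.coord x₀ x a = frameAt x₀ x hx (J x ((frameAt x₀ x hx).symm a)) := by
  rw [EndField.coord, ContinuousLinearMap.inCoordinates_eq hx hx]
  rfl

theorem eventually_mem_baseSet (x₀ : M) : ∀ᶠ x in nhds x₀,
    x ∈ (trivializationAt E (TangentSpace 𝓘(ℝ, E) : M → Type _) x₀).baseSet :=
  (trivializationAt E (TangentSpace 𝓘(ℝ, E) : M → Type _) x₀).open_baseSet.mem_nhds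
    (FiberBundle.mem_baseSet_trivializationAt' x₀)

theorem BilinField.IsSmooth.comp {B : BilinField E M} {J : EndField E M} (hB : B.IsSmooth)
    (hJ : J.IsSmooth) : BilinField.IsSmooth (fun x ↦ B x ∘L J x : BilinField E M) := by
  rw [BilinField.isSmooth_iff] at hB ⊢
  rw [EndField.isSmooth_iff] at hJ
  intro x₀
  refine ((hB x₀).clm_comp (hJ x₀)).congr_of_eventuallyEq ?_
  filter_upwards [eventually_mem_baseSet (E := E) x₀] with x hx
  ext a b
  simp [BilinField.coord_apply _ hx, EndField.coord_apply _ hx]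

theorem BilinField.IsSmooth.neg {B : BilinField E M} (hB : B.IsSmooth) :
    BilinField.IsSmooth (fun x ↦ -B x : BilinField E M) := by
  rw [BilinField.isSmooth_iff] at hB ⊢
  intro x₀
  refine (hB x₀).neg.congr_of_eventuallyEq ?_
  filter_upwards [eventually_mem_baseSet (E := E) x₀] with x hx
  ext a b
  simp [BilinField.coord_apply _ hx]

variable [FiniteDimensional ℝ E]

/-- `ContinuousLinearMap.inverse` is a true inverse only at invertible maps, hence the hypothesis on
β. This equation characterises β⁻¹α and replaces its definition from here on. -/
theorem invComp_spec {β α : TwoForm E M} (hβ : β.val.IsNondegenerate) (x : M)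
    (v w : TangentSpace 𝓘(ℝ, E) x) : β.val x (invComp β α x v) w = α.val x v w := by
  have := (hβ.isInvertible x).self_apply_inverse (α.val x v)
  exact congr($this w)

/-- In a local frame β⁻¹α is the inverse of the matrix of β times the matrix of α, and inversion is
smooth at invertible operators. -/
theorem TwoForm.isSmooth_invComp {β : TwoForm E M} (hβ : β.val.IsNondegenerate) (α : TwoForm E M) :
    (invComp β α).IsSmooth := by
  have hβs := β.val.isSmooth_iff.1 β.smooth
  have hαs := α.val.isSmooth_iff.1 α.smooth
  rw [EndField.isSmooth_iff]
  have hinv (x₀ x : M)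
      (hx : x ∈ (trivializationAt E (TangentSpace 𝓘(ℝ, E) : M → Type _) x₀).baseSet) :
      (β.val.coord x₀ x).IsInvertible := by
    apply isInvertible_of_injective
    rw [injective_iff_map_eq_zero]
    intro a ha
    rw [← (frameAt x₀ x hx).symm.map_eq_zero_iff]
    refine hβ x _ fun w ↦ ?_
    have := congr($ha (frameAt x₀ x hx w))
    simpa [BilinField.coord_apply _ hx] using this
  intro x₀
  obtain ⟨e, he⟩ := hinv x₀ x₀ (FiberBundle.mem_baseSet_trivializationAt' x₀)
  have h1 : ContMDiffAt 𝓘(ℝ, E) 𝓘(ℝ, (E →L[ℝ] ℝ) →L[ℝ] E) ∞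
      (fun x ↦ (β.val.coord x₀ x).inverse) x₀ := by
    have h2 : ContDiffAt ℝ ∞ ContinuousLinearMap.inverse (β.val.coord x₀ x₀) := by
      rw [← he]; exact contDiffAt_map_inverse e
    exact h2.contMDiffAt.comp x₀ (hβs x₀)
  refine (h1.clm_comp (hαs x₀)).congr_of_eventuallyEq ?_
  filter_upwards [eventually_mem_baseSet (E := E) x₀] with x hx
  -- The coordinate formula for β⁻¹α follows by cancelling the invertible matrix of β in this
  -- identity.
  have h3 : β.val.coord x₀ x ∘L (invComp β α).coord x₀ x = α.val.coord x₀ x := by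
    ext a b
    simp [BilinField.coord_apply _ hx, EndField.coord_apply _ hx, invComp_spec hβ]
  rw [← h3, ← ContinuousLinearMap.comp_assoc, (hinv x₀ x hx).inverse_comp_self]
  simp
end Smoothness

/-! ### Existence of the Levi-Civita connection by the Koszul formula. -/

section LeviCivita

variable {E : Type*} [NormedAddCommGroup E] [NormedSpace ℝ E]
  {M : Type*} [TopologicalSpace M] [ChartedSpace E M]

/-- The derivative `v(B(Y, Z))`. -/
def BilinField.deriv (B : BilinField E M) (Y Z : VField E M) (x : M)
    (v : TangentSpace 𝓘(ℝ, E) x) : ℝ :=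
  dirDeriv (fun y ↦ B y (Y y) (Z y)) x v

theorem BilinField.deriv_vec_add (B : BilinField E M) (Y Z : VField E M) {x : M}
    (v w : TangentSpace 𝓘(ℝ, E) x) : B.deriv Y Z x (v + w) = B.deriv Y Z x v + B.deriv Y Z x w :=
  dirDeriv_vec_add v w

theorem BilinField.deriv_vec_smul (B : BilinField E M) (Y Z : VField E M) {x : M} (c : ℝ)
    (v : TangentSpace 𝓘(ℝ, E) x) : B.deriv Y Z x (c • v) = c * B.deriv Y Z x v :=
  dirDeriv_vec_smul c v

theorem BilinField.deriv_neg_left (B : BilinField E M) (Y Z : VField E M) {x : M}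
    (v : TangentSpace 𝓘(ℝ, E) x) : B.deriv (-Y) Z x v = -B.deriv Y Z x v := by
  simp [BilinField.deriv, ← dirDeriv_neg]

variable [IsManifold 𝓘(ℝ, E) ∞ M]

section

variable {B : BilinField E M} (hB : B.IsSmooth) {Y Y' Z Z' : VField E M} {f : M → ℝ} {x : M}
  (v : TangentSpace 𝓘(ℝ, E) x)

include hB

theorem BilinField.IsSmooth.deriv_add_left (hY : DiffAt Y x) (hY' : DiffAt Y' x)
    (hZ : DiffAt Z x) : B.deriv (Y + Y') Z x v = B.deriv Y Z x v + B.deriv Y' Z x v := by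
  simp [BilinField.deriv,
    ← dirDeriv_add (hB.mdifferentiableAt hY hZ) (hB.mdifferentiableAt hY' hZ)]

theorem BilinField.IsSmooth.deriv_add_right (hY : DiffAt Y x) (hZ : DiffAt Z x)
    (hZ' : DiffAt Z' x) : B.deriv Y (Z + Z') x v = B.deriv Y Z x v + B.deriv Y Z' x v := by
  simp [BilinField.deriv,
    ← dirDeriv_add (hB.mdifferentiableAt hY hZ) (hB.mdifferentiableAt hY hZ')]

theorem BilinField.IsSmooth.deriv_smul_left (hf : MDifferentiableAt 𝓘(ℝ, E) 𝓘(ℝ, ℝ) f x)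
    (hY : DiffAt Y x) (hZ : DiffAt Z x) :
    B.deriv (f • Y) Z x v = f x * B.deriv Y Z x v + dirDeriv f x v * B x (Y x) (Z x) := by
  rw [mul_comm (dirDeriv f x v)]
  simp [BilinField.deriv, ← dirDeriv_mul hf (hB.mdifferentiableAt hY hZ)]

theorem BilinField.IsSmooth.deriv_smul_right (hf : MDifferentiableAt 𝓘(ℝ, E) 𝓘(ℝ, ℝ) f x)
    (hY : DiffAt Y x) (hZ : DiffAt Z x) :
    B.deriv Y (f • Z) x v = f x * B.deriv Y Z x v + dirDeriv f x v * B x (Y x) (Z x) := by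
  rw [mul_comm (dirDeriv f x v)]
  simp [BilinField.deriv, ← dirDeriv_mul hf (hB.mdifferentiableAt hY hZ)]

end

/-- The right-hand side of the Koszul formula for `2 g(∇_X Y, Z)`. -/
def PseudoRiemannianMetric.koszul (g : PseudoRiemannianMetric E M) (X Y Z : VField E M)
    (x : M) : ℝ :=
  g.val.deriv Y Z x (X x) + g.val.deriv X Z x (Y x) - g.val.deriv X Y x (Z x)
    + g.val x (mlieBracket 𝓘(ℝ, E) X Y x) (Z x) - g.val x (mlieBracket 𝓘(ℝ, E) X Z x) (Y x)
    - g.val x (mlieBracket 𝓘(ℝ, E) Y Z x) (X x)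

variable [FiniteDimensional ℝ E] (g : PseudoRiemannianMetric E M) {X X' Y Y' Z Z' : VField E M}
  {f : M → ℝ} {x : M}

theorem PseudoRiemannianMetric.koszul_add₁ (hX : DiffAt X x) (hX' : DiffAt X' x)
    (hY : DiffAt Y x) (hZ : DiffAt Z x) :
    g.koszul (X + X') Y Z x = g.koszul X Y Z x + g.koszul X' Y Z x := by
  simp only [koszul, g.smooth.deriv_add_left _ hX hX' hY, g.smooth.deriv_add_left _ hX hX' hZ,
    mlieBracket_add_left hX hX', Pi.add_apply, map_add, add_apply,
    BilinField.deriv_vec_add]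
  ring

theorem PseudoRiemannianMetric.koszul_add₂ (hX : DiffAt X x) (hY : DiffAt Y x)
    (hY' : DiffAt Y' x) (hZ : DiffAt Z x) :
    g.koszul X (Y + Y') Z x = g.koszul X Y Z x + g.koszul X Y' Z x := by
  simp only [koszul, g.smooth.deriv_add_left _ hY hY' hZ, g.smooth.deriv_add_right _ hX hY hY',
    mlieBracket_add_left hY hY', mlieBracket_add_right hY hY',
    Pi.add_apply, map_add, add_apply, BilinField.deriv_vec_add]
  ring

theorem PseudoRiemannianMetric.koszul_add₃ (hX : DiffAt X x) (hY : DiffAt Y x)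
    (hZ : DiffAt Z x) (hZ' : DiffAt Z' x) :
    g.koszul X Y (Z + Z') x = g.koszul X Y Z x + g.koszul X Y Z' x := by
  simp only [koszul, g.smooth.deriv_add_right _ hY hZ hZ', g.smooth.deriv_add_right _ hX hZ hZ',
    mlieBracket_add_right hZ hZ',
    Pi.add_apply, map_add, add_apply, BilinField.deriv_vec_add]
  ring

theorem lieBracket_smul_left (hf : MDifferentiableAt 𝓘(ℝ, E) 𝓘(ℝ, ℝ) f x) (hX : DiffAt X x) :
    mlieBracket 𝓘(ℝ, E) (f • X) Y x
      = -dirDeriv f x (Y x) • X x + f x • mlieBracket 𝓘(ℝ, E) X Y x :=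
  mlieBracket_smul_left hf hX

theorem lieBracket_smul_right (hf : MDifferentiableAt 𝓘(ℝ, E) 𝓘(ℝ, ℝ) f x) (hY : DiffAt Y x) :
    mlieBracket 𝓘(ℝ, E) X (f • Y) x
      = dirDeriv f x (X x) • Y x + f x • mlieBracket 𝓘(ℝ, E) X Y x :=
  mlieBracket_smul_right hf hY

theorem PseudoRiemannianMetric.koszul_smul₁ (hf : MDifferentiableAt 𝓘(ℝ, E) 𝓘(ℝ, ℝ) f x)
    (hX : DiffAt X x) (hY : DiffAt Y x) (hZ : DiffAt Z x) :
    g.koszul (f • X) Y Z x = f x * g.koszul X Y Z x := by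
  simp only [koszul, g.smooth.deriv_smul_left _ hf hX hY, g.smooth.deriv_smul_left _ hf hX hZ,
    lieBracket_smul_left hf hX, Pi.smul_apply', map_add, map_smul, add_apply,
    smul_apply, BilinField.deriv_vec_smul, smul_eq_mul]
  ring

/-- The Koszul expression is tensorial in X and Z but not in Y: the extra term, halved, is exactly
the Leibniz term of a connection. -/
theorem PseudoRiemannianMetric.koszul_smul₂ (hf : MDifferentiableAt 𝓘(ℝ, E) 𝓘(ℝ, ℝ) f x)
    (hX : DiffAt X x) (hY : DiffAt Y x) (hZ : DiffAt Z x) :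
    g.koszul X (f • Y) Z x
      = f x * g.koszul X Y Z x + 2 * dirDeriv f x (X x) * g.val x (Y x) (Z x) := by
  simp only [koszul, g.smooth.deriv_smul_left _ hf hY hZ, g.smooth.deriv_smul_right _ hf hX hY,
    lieBracket_smul_left hf hY, lieBracket_smul_right hf hY, Pi.smul_apply', map_add, map_smul,
    add_apply, smul_apply, BilinField.deriv_vec_smul,
    smul_eq_mul, g.symm x (X x) (Y x)]
  ring

theorem PseudoRiemannianMetric.koszul_smul₃ (hf : MDifferentiableAt 𝓘(ℝ, E) 𝓘(ℝ, ℝ) f x)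
    (hX : DiffAt X x) (hY : DiffAt Y x) (hZ : DiffAt Z x) :
    g.koszul X Y (f • Z) x = f x * g.koszul X Y Z x := by
  simp only [koszul, g.smooth.deriv_smul_right _ hf hY hZ, g.smooth.deriv_smul_right _ hf hX hZ,
    lieBracket_smul_right hf hZ, Pi.smul_apply', map_add, map_smul,
    add_apply, smul_apply, BilinField.deriv_vec_smul,
    smul_eq_mul, g.symm x (Z x)]
  ring

/-- The Koszul form as a tensor in its first and third arguments. -/
def PseudoRiemannianMetric.koszulForm (hY : DiffAt Y x) :
    TangentSpace 𝓘(ℝ, E) x →L[ℝ] TangentSpace 𝓘(ℝ, E) x →L[ℝ] ℝ :=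
  TensorialAt.mkHom₂ (I := 𝓘(ℝ, E)) (F := E) (F' := E) (fun X Z ↦ g.koszul X Y Z x) x
    (fun _ hZ ↦ ⟨fun hf hX ↦ g.koszul_smul₁ hf hX hY hZ, fun hX hX' ↦ g.koszul_add₁ hX hX' hY hZ⟩)
    (fun _ hX ↦ ⟨fun hf hZ ↦ g.koszul_smul₃ hf hX hY hZ, fun hZ hZ' ↦ g.koszul_add₃ hX hY hZ hZ'⟩)

theorem PseudoRiemannianMetric.koszulForm_apply (hX : DiffAt X x) (hY : DiffAt Y x)
    (hZ : DiffAt Z x) : g.koszulForm hY (X x) (Z x) = g.koszul X Y Z x :=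
  TensorialAt.mkHom₂_apply _ _ hX hZ

open Classical in
/-- The map `Y ↦ ∇Y` defined by the Koszul formula. -/
def PseudoRiemannianMetric.covDeriv (Y : VField E M) (x : M) :
    TangentSpace 𝓘(ℝ, E) x →L[ℝ] TangentSpace 𝓘(ℝ, E) x :=
  -- The axioms of a connection only constrain fields differentiable at x, so the value 0 at the
  -- others is harmless.
  if hY : DiffAt Y x then (1 / 2 : ℝ) • ((g.val x).inverse ∘L g.koszulForm hY) else 0

theorem PseudoRiemannianMetric.covDeriv_spec (hX : DiffAt X x) (hY : DiffAt Y x)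
    (hZ : DiffAt Z x) : g.val x (g.covDeriv Y x (X x)) (Z x) = 1 / 2 * g.koszul X Y Z x := by
  have := (g.nondegenerate.isInvertible x).self_apply_inverse (g.koszulForm hY (X x))
  rw [covDeriv, dif_pos hY, smul_apply, ContinuousLinearMap.comp_apply,
    map_smul, this, smul_apply, g.koszulForm_apply hX hY hZ, smul_eq_mul]

theorem PseudoRiemannianMetric.ext_of_diffAt {u v : TangentSpace 𝓘(ℝ, E) x}
    (h : ∀ Z : VField E M, DiffAt Z x → g.val x u (Z x) = g.val x v (Z x)) : u = v := by
  rw [← sub_eq_zero]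
  refine g.nondegenerate x _ fun w ↦ ?_
  obtain ⟨Z, hZ, rfl⟩ := exists_diffAt w
  rw [map_sub, sub_apply, h Z hZ, sub_self]

/-- The Levi-Civita connection of a pseudo-Riemannian metric. -/
def PseudoRiemannianMetric.leviCivita :
    CovariantDerivative 𝓘(ℝ, E) E (TangentSpace 𝓘(ℝ, E) : M → Type _) where
  toFun := g.covDeriv
  isCovariantDerivativeOnUniv :=
    { add := fun {Y Y' x} hY hY' _ ↦ by
        ext v
        obtain ⟨X, hX, rfl⟩ := exists_diffAt v
        refine g.ext_of_diffAt fun Z hZ ↦ ?_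
        rw [g.covDeriv_spec hX (DiffAt.add hY hY') hZ, g.koszul_add₂ hX hY hY' hZ,
          add_apply, map_add, add_apply,
          g.covDeriv_spec hX hY hZ, g.covDeriv_spec hX hY' hZ]
        ring
      leibniz := fun {Y f x} hY hf _ ↦ by
        ext v
        obtain ⟨X, hX, rfl⟩ := exists_diffAt v
        refine g.ext_of_diffAt fun Z hZ ↦ ?_
        rw [g.covDeriv_spec hX (DiffAt.smul hf hY) hZ, g.koszul_smul₂ hf hX hY hZ,
          add_apply, map_add, add_apply,
          smul_apply, map_smul, smul_apply,
          g.covDeriv_spec hX hY hZ, ContinuousLinearMap.smulRight_apply, map_smul,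
          smul_apply]
        simp only [smul_eq_mul, dirDeriv]
        ring }

/-- Swapping X and Y in the Koszul expression and subtracting leaves 2g([X,Y], Z), which is
torsion-freeness. Swapping Y and Z and adding leaves 2X(g(Y,Z)), which is metric compatibility. -/
theorem PseudoRiemannianMetric.isLeviCivita_leviCivita : IsLeviCivita g g.leviCivita where
  torsion_free := by
    rw [CovariantDerivative.torsion_eq_zero_iff]
    intro X Y x hX hY
    refine g.ext_of_diffAt fun Z hZ ↦ ?_
    change g.val x (g.covDeriv Y x (X x) - g.covDeriv X x (Y x)) (Z x) = _
    rw [map_sub, sub_apply, g.covDeriv_spec hX hY hZ, g.covDeriv_spec hY hX hZ]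
    have h : g.val.deriv X Y x = g.val.deriv Y X x := by
      unfold BilinField.deriv; simp_rw [g.symm _ (X _)]
    simp only [koszul, h, mlieBracket_swap_apply (V := Y) (W := X), map_neg,
      neg_apply]
    ring
  metric := by
    intro x v Y Z hY hZ
    obtain ⟨X, hX, rfl⟩ := exists_diffAt v
    change g.val.deriv Y Z x (X x) =
      g.val x (g.covDeriv Y x (X x)) (Z x) + g.val x (Y x) (g.covDeriv Z x (X x))
    rw [g.symm x (Y x), g.covDeriv_spec hX hY hZ, g.covDeriv_spec hX hZ hY]
    have h : g.val.deriv Z Y x = g.val.deriv Y Z x := by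
      unfold BilinField.deriv; simp_rw [g.symm _ (Z _)]
    simp only [koszul, h, mlieBracket_swap_apply (V := Z) (W := Y), map_neg,
      neg_apply]
    ring

end LeviCivita

/-! ### Closed forms, the Nijenhuis tensor and parallel complex structures. -/

section Parallel

variable {E : Type*} [NormedAddCommGroup E] [NormedSpace ℝ E]
  {M : Type*} [TopologicalSpace M] [ChartedSpace E M] [IsManifold 𝓘(ℝ, E) ∞ M]

theorem TwoForm.antisymm (η : TwoForm E M) (x : M) (v w : TangentSpace 𝓘(ℝ, E) x) :
    η.val x v w = -η.val x w v := by
  have := η.alternating x (v + w)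
  simp only [map_add, add_apply, η.alternating] at this
  linarith

omit [IsManifold 𝓘(ℝ, E) ∞ M] in
theorem EndField.app_app {J : EndField E M} (hJ : ∀ x v, J x (J x v) = -v) (Y : VField E M) :
    J.app (J.app Y) = -Y :=
  funext fun x ↦ hJ x (Y x)

/-- If `J` is an almost complex structure and `ω₂ - i ω₃` is a closed form of type `(2, 0)`, then
the Nijenhuis tensor of `J` vanishes. -/
theorem nijenhuis_eq_zero {ω₂ ω₃ : TwoForm E M} {J : EndField E M} (hJs : J.IsSmooth)
    (hJ : ∀ x v, J x (J x v) = -v) (h₃ : ∀ x v w, ω₃.val x v w = -ω₂.val x (J x v) w)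
    (h₂ : ∀ x v w, ω₂.val x (J x v) w = ω₂.val x v (J x w)) (hnd : ω₂.val.IsNondegenerate)
    (hω₂ : ω₂.IsClosed) (hω₃ : ω₃.IsClosed) [FiniteDimensional ℝ E]
    {X Y : VField E M} {x : M} (hX : DiffAt X x) (hY : DiffAt Y x) :
    mlieBracket 𝓘(ℝ, E) (J.app X) (J.app Y) x - mlieBracket 𝓘(ℝ, E) X Y x
      - J x (mlieBracket 𝓘(ℝ, E) (J.app X) Y x) - J x (mlieBracket 𝓘(ℝ, E) X (J.app Y) x) = 0 := by
  refine hnd x _ fun w ↦ ?_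
  obtain ⟨Z, hZ, rfl⟩ := exists_diffAt w
  have d₃ (U V : VField E M) (v) : ω₃.val.deriv U V x v = -ω₂.val.deriv (J.app U) V x v := by
    rw [BilinField.deriv, BilinField.deriv, ← dirDeriv_neg]
    simp_rw [h₃, EndField.app_apply]
  have d₂ (U V : VField E M) (v) :
      ω₂.val.deriv (J.app U) (J.app V) x v = -ω₂.val.deriv U V x v := by
    rw [BilinField.deriv, BilinField.deriv, ← dirDeriv_neg]
    simp_rw [EndField.app_apply, h₂, hJ, map_neg]
  -- With Ω = ω₂ + iω₃, the combination e₁ - e₂ - e₃ - e₄ is the real part of dΩ(X + iJX, Y + iJY,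
  -- Z) = 0. Since Ω kills X + iJX and Y + iJY, only the bracket term survives, and its real part is
  -- ω₂(N(X,Y), Z).
  have e₁ := hω₂ x X Y Z hX hY hZ
  have e₂ := hω₂ x (J.app X) (J.app Y) Z (hX.app hJs) (hY.app hJs) hZ
  have e₃ := hω₃ x (J.app X) Y Z (hX.app hJs) hY hZ
  have e₄ := hω₃ x X (J.app Y) Z hX (hY.app hJs) hZ
  simp only [extDerivOn, ← BilinField.deriv.eq_1] at e₁ e₂ e₃ e₄
  simp only [d₃, d₂, EndField.app_app hJ, BilinField.deriv_neg_left, h₃, h₂,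
    EndField.app_apply, hJ, map_neg] at e₁ e₂ e₃ e₄
  simp only [map_sub, sub_apply, h₂]
  linarith

section

variable [FiniteDimensional ℝ E]
  (cov : CovariantDerivative 𝓘(ℝ, E) E (TangentSpace 𝓘(ℝ, E) : M → Type _))

/-- The derivative `(∇_v J) Y = ∇_v (J Y) - J ∇_v Y`. -/
def EndField.covDeriv (J : EndField E M) (Y : VField E M) (x : M) (v : TangentSpace 𝓘(ℝ, E) x) :
    TangentSpace 𝓘(ℝ, E) x :=
  cov (J.app Y) x v - J x (cov Y x v)

omit [FiniteDimensional ℝ E] in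
theorem cov_neg {Y : VField E M} {x : M} (hY : DiffAt Y x) : cov (-Y) x = -cov Y x := by
  have := cov.isCovariantDerivativeOn.smul_const (s := Set.univ) (x := x) (-1 : ℝ) hY
  simpa using this

-- Differentiating J² = -1 shows that ∇J anticommutes with J.
omit [FiniteDimensional ℝ E] in
theorem EndField.covDeriv_app {J : EndField E M} (hJ : ∀ x v, J x (J x v) = -v) {Y : VField E M}
    {x : M} (hY : DiffAt Y x) (v : TangentSpace 𝓘(ℝ, E) x) :
    J.covDeriv cov (J.app Y) x v = -J x (J.covDeriv cov Y x v) := by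
  rw [covDeriv, covDeriv, app_app hJ, cov_neg cov hY, map_sub, hJ, neg_apply]
  abel

variable {cov} {g : PseudoRiemannianMetric E M} (hcov : IsLeviCivita g cov)
include hcov

theorem IsLeviCivita.mlieBracket_eq {X Y : VField E M} {x : M} (hX : DiffAt X x)
    (hY : DiffAt Y x) : mlieBracket 𝓘(ℝ, E) X Y x = cov Y x (X x) - cov X x (Y x) :=
  (cov.torsion_eq_zero_iff.1 hcov.torsion_free hX hY).symm

variable {η : TwoForm E M} {J : EndField E M} (hJs : J.IsSmooth)
  (hη : ∀ x v w, η.val x v w = g.val x (J x v) w)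
include hJs hη

theorem IsLeviCivita.deriv_twoForm {Y Z : VField E M} {x : M} (v : TangentSpace 𝓘(ℝ, E) x)
    (hY : DiffAt Y x) (hZ : DiffAt Z x) :
    η.val.deriv Y Z x v = g.val x (cov (J.app Y) x v) (Z x) - g.val x (J x (cov Z x v)) (Y x) := by
  rw [← hη, η.antisymm x _ (Y x), hη, sub_neg_eq_add]
  refine Eq.trans ?_ (hcov.metric x v (J.app Y) Z (hY.app hJs) hZ)
  simp_rw [BilinField.deriv, hη, EndField.app_apply]

/-- Metric compatibility expands the derivatives and torsion-freeness the brackets; all terms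
without a derivative of J cancel. This is the cyclic sum of ∇η, written with ∇J. -/
theorem IsLeviCivita.extDerivOn_eq {X Y Z : VField E M} {x : M} (hX : DiffAt X x)
    (hY : DiffAt Y x) (hZ : DiffAt Z x) :
    extDerivOn η X Y Z x = g.val x (J.covDeriv cov Y x (X x)) (Z x)
      - g.val x (J.covDeriv cov X x (Y x)) (Z x) + g.val x (J.covDeriv cov X x (Z x)) (Y x) := by
  simp only [extDerivOn, ← BilinField.deriv.eq_1, hcov.deriv_twoForm hJs hη _ hX hY,
    hcov.deriv_twoForm hJs hη _ hX hZ, hcov.deriv_twoForm hJs hη _ hY hZ,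
    hcov.mlieBracket_eq hX hY, hcov.mlieBracket_eq hX hZ, hcov.mlieBracket_eq hY hZ,
    EndField.covDeriv, map_sub, sub_apply]
  simp only [hη]
  ring

theorem IsLeviCivita.isClosed (hpar : IsParallel cov J) : η.IsClosed := by
  intro x X Y Z hX hY hZ
  have h {Y : VField E M} (hY : DiffAt Y x) (v) : J.covDeriv cov Y x v = 0 :=
    sub_eq_zero.2 (hpar x v Y hY)
  simp [hcov.extDerivOn_eq hJs hη hX hY hZ, h hX, h hY]

/-- A pseudo-Hermitian structure whose fundamental form is closed and whose almost complex
structure has vanishing Nijenhuis tensor is pseudo-Kähler. -/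
theorem IsLeviCivita.isParallel (hJ : ∀ x v, J x (J x v) = -v) (hclosed : η.IsClosed)
    (hN : ∀ (x : M) (X Y : VField E M), DiffAt X x → DiffAt Y x →
      mlieBracket 𝓘(ℝ, E) (J.app X) (J.app Y) x - mlieBracket 𝓘(ℝ, E) X Y x
      - J x (mlieBracket 𝓘(ℝ, E) (J.app X) Y x) - J x (mlieBracket 𝓘(ℝ, E) X (J.app Y) x) = 0) :
    IsParallel cov J := by
  intro x v Y hY
  obtain ⟨X, hX, rfl⟩ := exists_diffAt v
  rw [← sub_eq_zero]
  refine g.nondegenerate x _ fun w ↦ ?_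
  obtain ⟨Z, hZ, rfl⟩ := exists_diffAt w
  -- Here a(X,Y,Z) = g((∇_X J)Y, Z). The goal a = 0 comes from its symmetries: `anti` from η being
  -- alternating, `move` from J² = -1, `symm₁₂` from the Nijenhuis tensor, `closed` from dη = 0.
  set a : VField E M → VField E M → VField E M → ℝ :=
    fun X Y Z ↦ g.val x (J.covDeriv cov Y x (X x)) (Z x) with ha
  change a X Y Z = 0
  have skew (v w : TangentSpace 𝓘(ℝ, E) x) : g.val x (J x v) w = -g.val x v (J x w) := by
    rw [← hη, η.antisymm, hη, g.symm]
  have anti {X Y Z : VField E M} (hY : DiffAt Y x) (hZ : DiffAt Z x) :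
      a X Y Z = -a X Z Y := by
    have h₁ := hcov.deriv_twoForm hJs hη (X x) hY hZ
    have h₂ := hcov.deriv_twoForm hJs hη (X x) hZ hY
    have h₃ : η.val.deriv Y Z x (X x) = -η.val.deriv Z Y x (X x) := by
      rw [BilinField.deriv, BilinField.deriv, ← dirDeriv_neg]
      simp_rw [← η.antisymm]
    simp only [ha, EndField.covDeriv, map_sub, sub_apply]
    linarith
  have move {X Y Z : VField E M} (hY : DiffAt Y x) : a X (J.app Y) Z = a X Y (J.app Z) := by
    simp only [ha, EndField.covDeriv_app cov hJ hY, map_neg, neg_apply, skew, neg_neg,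
      EndField.app_apply]
  have sq (X Y Z : VField E M) : a X Y (J.app (J.app Z)) = -a X Y Z := by
    simp [ha, EndField.app_app hJ]
  have symm₁₂ {X Y : VField E M} (Z : VField E M) (hX : DiffAt X x) (hY : DiffAt Y x) :
      a (J.app X) Y Z + a X Y (J.app Z) = a (J.app Y) X Z + a Y X (J.app Z) := by
    have h := hN x X Y hX hY
    rw [hcov.mlieBracket_eq hX hY, hcov.mlieBracket_eq (hX.app hJs) hY,
      hcov.mlieBracket_eq hX (hY.app hJs), hcov.mlieBracket_eq (hX.app hJs) (hY.app hJs)] at h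
    have h' := congr(g.val x $h (Z x))
    simp only [map_sub, sub_apply, map_zero, zero_apply, EndField.app_apply, skew] at h'
    simp only [ha, EndField.covDeriv, map_sub, sub_apply, EndField.app_apply, skew, hJ, map_neg]
    linarith
  have anti₂₃ {X Y Z : VField E M} (hY : DiffAt Y x) (hZ : DiffAt Z x) :
      a (J.app X) Y Z + a X Y (J.app Z) = -(a (J.app X) Z Y + a X Z (J.app Y)) := by
    rw [anti hY hZ, anti hY (hZ.app hJs), move hZ]
    ring
  -- The tensor a(JX,Y,Z) + a(X,Y,JZ) is symmetric in X, Y and antisymmetric in Y, Z. Applying the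
  -- two swaps alternately three times each returns it to itself with the opposite sign, so it is
  -- zero.
  have hol {X Y Z : VField E M} (hX : DiffAt X x) (hY : DiffAt Y x) (hZ : DiffAt Z x) :
      a (J.app X) Y Z = -a X Y (J.app Z) := by
    linarith [symm₁₂ Z hX hY, anti₂₃ (X := Y) hX hZ, symm₁₂ X hY hZ, anti₂₃ (X := Z) hY hX,
      symm₁₂ Y hZ hX, anti₂₃ (X := X) hZ hY]
  have closed {X Y Z : VField E M} (hX : DiffAt X x) (hY : DiffAt Y x) (hZ : DiffAt Z x) :
      a X Y Z - a Y X Z + a Z X Y = 0 :=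
    (hcov.extDerivOn_eq hJs hη hX hY hZ).symm.trans (hclosed x X Y Z hX hY hZ)
  -- Replacing (Y,Z) by (JY,JZ) in the closedness identity changes the sign of its first term and
  -- keeps the other two, so the difference of both identities is 2a(X,Y,Z) = 0.
  have h := closed hX (hY.app hJs) (hZ.app hJs)
  rw [move hY, sq, hol hY hX (hZ.app hJs), sq, hol hZ hX (hY.app hJs), sq] at h
  linarith [closed hX hY hZ]

end

end Parallel

/-! ### The quaternion relations. -/

section Quaternions

variable {V F : Type*} [AddCommGroup V] [FunLike F V V] [AddMonoidHomClass F V V] {I J K : F}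

/-- The multiplication table of the imaginary quaternions. -/
theorem quaternion_mul_table (hI : ∀ v, I (I v) = -v) (hJ : ∀ v, J (J v) = -v)
    (hK : ∀ v, K (K v) = -v) (hIJK : ∀ v, I (J (K v)) = -v) (v : V) :
    (I (J v) = K v ∧ J (K v) = I v ∧ K (I v) = J v) ∧
      (J (I v) = -K v ∧ K (J v) = -I v ∧ I (K v) = -J v) := by
  have hIJ (v : V) : I (J v) = K v := by simpa [hK] using hIJK (K v)
  have hJK (v : V) : J (K v) = I v := by
    rw [← neg_inj, ← hI, hIJK, map_neg]
  have hJI (v : V) : J (I v) = -K v := by rw [← hJK, hJ]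
  have hKI (v : V) : K (I v) = J v := by
    rw [← neg_inj, ← hJI, hI, map_neg]
  exact ⟨⟨hIJ v, hJK v, hKI v⟩, hJI v, by rw [← hKI, hK], by rw [← hIJ, hI]⟩

end Quaternions

/-! ### From closed forms to a hyperkähler structure. -/

section

variable {E : Type*} [NormedAddCommGroup E] [NormedSpace ℝ E]
  {M : Type*} [TopologicalSpace M] [ChartedSpace E M] [IsManifold 𝓘(ℝ, E) ∞ M]

/-- Three non-degenerate 2-forms with the almost complex structures `J₁ = ω₃⁻¹ ω₂`,
`J₂ = ω₁⁻¹ ω₃`, `J₃ = ω₂⁻¹ ω₁`. -/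
structure IsSymplecticTriple (ω₁ ω₂ ω₃ : TwoForm E M) (J₁ J₂ J₃ : EndField E M) : Prop where
  nondegenerate₁ : ω₁.val.IsNondegenerate
  nondegenerate₂ : ω₂.val.IsNondegenerate
  nondegenerate₃ : ω₃.val.IsNondegenerate
  smooth₁ : J₁.IsSmooth
  smooth₂ : J₂.IsSmooth
  smooth₃ : J₃.IsSmooth
  sq₁ : ∀ x v, J₁ x (J₁ x v) = -v
  sq₂ : ∀ x v, J₂ x (J₂ x v) = -v
  sq₃ : ∀ x v, J₃ x (J₃ x v) = -v
  spec₁ : ∀ x v w, ω₃.val x (J₁ x v) w = ω₂.val x v w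
  spec₂ : ∀ x v w, ω₁.val x (J₂ x v) w = ω₃.val x v w
  spec₃ : ∀ x v w, ω₂.val x (J₃ x v) w = ω₁.val x v w

namespace IsSymplecticTriple

variable {ω₁ ω₂ ω₃ : TwoForm E M} {J₁ J₂ J₃ : EndField E M}
  (T : IsSymplecticTriple ω₁ ω₂ ω₃ J₁ J₂ J₃)
include T

/-- Cyclic symmetry: facts about the first index yield those about the other two. -/
theorem rotate : IsSymplecticTriple ω₂ ω₃ ω₁ J₂ J₃ J₁ :=
  ⟨T.nondegenerate₂, T.nondegenerate₃, T.nondegenerate₁, T.smooth₂, T.smooth₃, T.smooth₁,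
    T.sq₂, T.sq₃, T.sq₁, T.spec₂, T.spec₃, T.spec₁⟩

/-- Both J₂J₁ and -J₃ are ω₁⁻¹ω₂: the first since ω₁J₂J₁ = ω₃J₁ = ω₂, the second since ω₂J₃ = ω₁ and
J₃² = -1. Hence J₂J₁ = -J₃, and the squares give the rest. -/
theorem mul_eq (x : M) (v : TangentSpace 𝓘(ℝ, E) x) : J₁ x (J₂ x (J₃ x v)) = -v := by
  have h (v) : J₂ x (J₁ x v) = -J₃ x v := by
    rw [← sub_eq_zero]
    refine T.nondegenerate₁ x _ fun w ↦ ?_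
    rw [map_sub, sub_apply, T.spec₂, T.spec₁, map_neg, neg_apply, ← T.spec₃, T.sq₃, map_neg,
      neg_apply, sub_neg_eq_add, add_neg_cancel]
  rw [← neg_neg (J₃ x v), ← h, map_neg, T.sq₂, neg_neg, T.sq₁]

theorem form₃_eq (x : M) (v w : TangentSpace 𝓘(ℝ, E) x) :
    ω₃.val x v w = -ω₂.val x (J₁ x v) w := by
  rw [← T.spec₁, T.sq₁, map_neg, neg_apply, neg_neg]

/-- Self-adjointness of J₁ for ω₂ expresses that ω₂(J₁·, ·) = -ω₃ is again antisymmetric. -/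
theorem form₂_selfAdjoint (x : M) (v w : TangentSpace 𝓘(ℝ, E) x) :
    ω₂.val x (J₁ x v) w = ω₂.val x v (J₁ x w) := by
  rw [← neg_inj, ← T.form₃_eq, ← ω₂.antisymm, ω₃.antisymm, T.form₃_eq, neg_neg]

theorem form₁_selfAdjoint (x : M) (v w : TangentSpace 𝓘(ℝ, E) x) :
    ω₁.val x (J₂ x v) w = ω₁.val x v (J₂ x w) := by
  rw [T.spec₂, ω₃.antisymm, ← T.spec₂, ← ω₁.antisymm]

theorem rotate_apply (x : M) (v w : TangentSpace 𝓘(ℝ, E) x) :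
    ω₂.val x (J₂ x v) w = ω₁.val x (J₁ x v) w := by
  rw [← T.spec₃ x (J₁ x v),
    (quaternion_mul_table (T.sq₁ x) (T.sq₂ x) (T.sq₃ x) (T.mul_eq x) v).1.2.2]

/-- J₁ = J₂J₃ is a product of two anticommuting ω₁-self-adjoint maps, hence ω₁-skew, and ω₁ is
itself antisymmetric. -/
theorem apply_symm (x : M) (v w : TangentSpace 𝓘(ℝ, E) x) :
    ω₁.val x (J₁ x v) w = ω₁.val x (J₁ x w) v := by
  have h := quaternion_mul_table (T.sq₁ x) (T.sq₂ x) (T.sq₃ x) (T.mul_eq x)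
  rw [← (h v).1.2.1, T.form₁_selfAdjoint, T.rotate.rotate.form₂_selfAdjoint, (h w).2.2.1, map_neg,
    ← ω₁.antisymm]

/-- The metric `g = -ω₁(J₁ ·, ·)`. -/
def metric : PseudoRiemannianMetric E M where
  -- The sign is the one for which ω₁ = g(J₁·, ·).
  val x := -(ω₁.val x ∘L J₁ x)
  symm x v w := congr(-$(T.apply_symm x v w))
  nondegenerate x v h := by
    have h₁ : J₁ x v = 0 := T.nondegenerate₁ x _ fun w ↦ neg_eq_zero.1 (h w)
    rw [← neg_eq_zero, ← T.sq₁, h₁, map_zero]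
  smooth := (ω₁.smooth.comp T.smooth₁).neg

theorem metric_apply (x : M) (v w : TangentSpace 𝓘(ℝ, E) x) :
    T.metric.val x v w = -ω₁.val x (J₁ x v) w := rfl

theorem metric_rotate (x : M) (v w : TangentSpace 𝓘(ℝ, E) x) :
    T.rotate.metric.val x v w = T.metric.val x v w := by
  rw [metric_apply, metric_apply, T.rotate_apply]

theorem metric_hermitian (x : M) (v w : TangentSpace 𝓘(ℝ, E) x) :
    T.metric.val x (J₁ x v) (J₁ x w) = T.metric.val x v w := by
  rw [T.metric.symm x v, metric_apply, metric_apply, T.sq₁, map_neg, neg_apply, neg_neg,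
    ω₁.antisymm]

theorem form₁_eq (x : M) (v w : TangentSpace 𝓘(ℝ, E) x) :
    ω₁.val x v w = T.metric.val x (J₁ x v) w := by
  rw [metric_apply, T.sq₁, map_neg, neg_apply, neg_neg]

variable [FiniteDimensional ℝ E]

/-- The metric g is only required to agree pointwise with that of the triple, so that one fixed
connection serves all three rotated triples. -/
theorem isParallel {g : PseudoRiemannianMetric E M} (hg : ∀ x v w, g.val x v w = T.metric.val x v w)
    {cov : CovariantDerivative 𝓘(ℝ, E) E (TangentSpace 𝓘(ℝ, E) : M → Type _)}
    (hcov : IsLeviCivita g cov) (h₁ : ω₁.IsClosed) (h₂ : ω₂.IsClosed) (h₃ : ω₃.IsClosed) :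
    IsParallel cov J₁ :=
  hcov.isParallel T.smooth₁ (fun x v w ↦ by rw [hg, T.form₁_eq]) T.sq₁ h₁
    fun _ _ _ hX hY ↦ nijenhuis_eq_zero T.smooth₁ T.sq₁ T.form₃_eq T.form₂_selfAdjoint
      T.nondegenerate₂ h₂ h₃ hX hY

theorem isHyperkahler (h₁ : ω₁.IsClosed) (h₂ : ω₂.IsClosed) (h₃ : ω₃.IsClosed) :
    IsHyperkahler E M := by
  have hg := T.metric_rotate
  have hg' (x v w) := (T.rotate.metric_rotate x v w).trans (hg x v w)
  exact ⟨{
    g := T.metric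
    cov := T.metric.leviCivita
    leviCivita := T.metric.isLeviCivita_leviCivita
    J := ![J₁, J₂, J₃]
    smooth := by
      rw [Fin.forall_fin_succ, Fin.forall_fin_two]
      exact ⟨T.smooth₁, T.smooth₂, T.smooth₃⟩
    sq_eq := by
      rw [Fin.forall_fin_succ, Fin.forall_fin_two]
      exact ⟨T.sq₁, T.sq₂, T.sq₃⟩
    mul_eq := T.mul_eq
    hermitian := by
      rw [Fin.forall_fin_succ, Fin.forall_fin_two]
      refine ⟨T.metric_hermitian, fun x v w ↦ ?_, fun x v w ↦ ?_⟩
      · rw [← hg, ← hg]; exact T.rotate.metric_hermitian x v w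
      · rw [← hg', ← hg']; exact T.rotate.rotate.metric_hermitian x v w
    parallel := by
      rw [Fin.forall_fin_succ, Fin.forall_fin_two]
      have hLC := T.metric.isLeviCivita_leviCivita
      exact ⟨T.isParallel (fun _ _ _ ↦ rfl) hLC h₁ h₂ h₃,
        T.rotate.isParallel (fun x v w ↦ (hg x v w).symm) hLC h₂ h₃ h₁,
        T.rotate.rotate.isParallel (fun x v w ↦ (hg' x v w).symm) hLC h₃ h₁ h₂⟩ }⟩

end IsSymplecticTriple

end

/-! ### From a hyperkähler structure to closed forms. -/

section

variable {E : Type*} [NormedAddCommGroup E] [NormedSpace ℝ E] [FiniteDimensional ℝ E]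
  {M : Type*} [TopologicalSpace M] [ChartedSpace E M] [IsManifold 𝓘(ℝ, E) ∞ M]

theorem invComp_eq {β α : TwoForm E M} {J : EndField E M} (hβ : β.val.IsNondegenerate)
    (h : ∀ x v w, β.val x (J x v) w = α.val x v w) : invComp β α = J := by
  ext x v
  rw [← sub_eq_zero]
  refine hβ x _ fun w ↦ ?_
  rw [map_sub, sub_apply, invComp_spec hβ, h, sub_self]

theorem linearIndependent_triple {W : Type*} [AddCommMonoid W] [Module ℝ W] {A B C : W}
    (h : ∀ a b c : ℝ, a • A + b • B + c • C = 0 → a = 0 ∧ b = 0 ∧ c = 0) :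
    LinearIndependent ℝ ![A, B, C] := by
  -- Negatives are supplied by the scalar -1.
  let : AddCommGroup W := Module.addCommMonoidToAddCommGroup ℝ
  refine Fintype.linearIndependent_iff.2 fun a ha ↦ ?_
  rw [Fin.forall_fin_succ, Fin.forall_fin_two]
  exact h _ _ _ (by simpa [Fin.sum_univ_three] using ha)

namespace HyperkahlerStructure

variable (H : HyperkahlerStructure E M)

theorem mul_table (x : M) (v : TangentSpace 𝓘(ℝ, E) x) :
    (H.J 0 x (H.J 1 x v) = H.J 2 x v ∧ H.J 1 x (H.J 2 x v) = H.J 0 x v ∧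
        H.J 2 x (H.J 0 x v) = H.J 1 x v) ∧
      (H.J 1 x (H.J 0 x v) = -H.J 2 x v ∧ H.J 2 x (H.J 1 x v) = -H.J 0 x v ∧
        H.J 0 x (H.J 2 x v) = -H.J 1 x v) :=
  quaternion_mul_table (H.sq_eq 0 x) (H.sq_eq 1 x) (H.sq_eq 2 x) (H.mul_eq x) v

/-- The fundamental 2-form `g(J i ·, ·)`. -/
def form (i : Fin 3) : TwoForm E M where
  val x := H.g.val x ∘L H.J i x
  alternating x v := by
    -- Evaluated at (Jv, v), the Hermitian identity says that g(Jv, v) equals its own negative.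
    have h := H.hermitian i x (H.J i x v) v
    rw [H.sq_eq, map_neg, neg_apply, H.g.symm] at h
    change H.g.val x (H.J i x v) v = 0
    linarith
  smooth := H.g.smooth.comp (H.smooth i)

theorem form_apply (i : Fin 3) (x : M) (v w : TangentSpace 𝓘(ℝ, E) x) :
    (H.form i).val x v w = H.g.val x (H.J i x v) w := rfl

theorem form_nondegenerate (i : Fin 3) : (H.form i).val.IsNondegenerate := fun x v h ↦ by
  have h₁ : H.J i x v = 0 := H.g.nondegenerate x _ h
  rw [← neg_eq_zero, ← H.sq_eq i, h₁, map_zero]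

theorem form_isClosed (i : Fin 3) : (H.form i).IsClosed :=
  H.leviCivita.isClosed (H.smooth i) (H.form_apply i) (H.parallel i)

theorem form_linearIndependent [Nontrivial E] (x : M) :
    LinearIndependent ℝ ![(H.form 0).val x, (H.form 1).val x, (H.form 2).val x] := by
  refine linearIndependent_triple fun a b c ha ↦ ?_
  obtain ⟨v, hv⟩ : ∃ v : TangentSpace 𝓘(ℝ, E) x, v ≠ 0 := exists_ne (0 : E)
  have hq (v) : a • H.J 0 x v + b • H.J 1 x v + c • H.J 2 x v = 0 := by
    refine H.g.nondegenerate x _ fun w ↦ ?_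
    have h : a * H.g.val x (H.J 0 x v) w + b * H.g.val x (H.J 1 x v) w
      + c * H.g.val x (H.J 2 x v) w = 0 := congr($ha v w)
    simpa using h
  have h : (a ^ 2 + b ^ 2 + c ^ 2) • v = 0 := by
    -- The operator aJ₁ + bJ₂ + cJ₃ is applied twice: anticommutation kills the cross terms and its
    -- square is -(a² + b² + c²).
    have h := hq (a • H.J 0 x v + b • H.J 1 x v + c • H.J 2 x v)
    obtain ⟨⟨h₁, h₂, h₃⟩, h₄, h₅, h₆⟩ := H.mul_table x v
    simp only [map_add, map_smul, H.sq_eq, h₁, h₂, h₃, h₄, h₅, h₆] at h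
    rw [← neg_eq_zero, ← h]
    module
  have h' := (smul_eq_zero.1 h).resolve_right hv
  refine ⟨?_, ?_, ?_⟩ <;> nlinarith [sq_nonneg a, sq_nonneg b, sq_nonneg c]

end HyperkahlerStructure

end

end Hyperkahler

end
-- The equivalence.
open Hyperkahler in
theorem theorem2p1
    {E : Type*} [NormedAddCommGroup E] [NormedSpace ℝ E] [FiniteDimensional ℝ E] [Nontrivial E]
    {M : Type*} [TopologicalSpace M] [T2Space M] [SecondCountableTopology M]
    [ChartedSpace E M] [IsManifold 𝓘(ℝ, E) ∞ M] :
    IsHyperkahler E M ↔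
      ∃ ω₁ ω₂ ω₃ : TwoForm E M,
        -- non-degenerate
        (ω₁.val.IsNondegenerate ∧ ω₂.val.IsNondegenerate ∧ ω₃.val.IsNondegenerate) ∧
        -- pointwise linearly independent
        (∀ x, LinearIndependent ℝ ![ω₁.val x, ω₂.val x, ω₃.val x]) ∧
        -- the algebraic condition
        (∀ (x : M) (v : TangentSpace 𝓘(ℝ, E) x),
          invComp ω₃ ω₂ x (invComp ω₃ ω₂ x v) = -v ∧
          invComp ω₁ ω₃ x (invComp ω₁ ω₃ x v) = -v ∧
          invComp ω₂ ω₁ x (invComp ω₂ ω₁ x v) = -v) ∧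
        -- the exterior differential condition
        (ω₁.IsClosed ∧ ω₂.IsClosed ∧ ω₃.IsClosed) := by
  constructor
  · rintro ⟨H⟩
    refine ⟨H.form 0, H.form 1, H.form 2,
      ⟨H.form_nondegenerate 0, H.form_nondegenerate 1, H.form_nondegenerate 2⟩,
      H.form_linearIndependent, fun x v ↦ ?_,
      H.form_isClosed 0, H.form_isClosed 1, H.form_isClosed 2⟩
    -- J₃J₁ = J₂ gives ω₃(J₁v, w) = g(J₂v, w) = ω₂(v, w); the other two are cyclic.
    have h₀ : invComp (H.form 2) (H.form 1) = H.J 0 :=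
      invComp_eq (H.form_nondegenerate 2) fun x v w ↦ by
        rw [H.form_apply, H.form_apply, (H.mul_table x v).1.2.2]
    have h₁ : invComp (H.form 0) (H.form 2) = H.J 1 :=
      invComp_eq (H.form_nondegenerate 0) fun x v w ↦ by
        rw [H.form_apply, H.form_apply, (H.mul_table x v).1.1]
    have h₂ : invComp (H.form 1) (H.form 0) = H.J 2 :=
      invComp_eq (H.form_nondegenerate 1) fun x v w ↦ by
        rw [H.form_apply, H.form_apply, (H.mul_table x v).1.2.1]
    rw [h₀, h₁, h₂]
    exact ⟨H.sq_eq 0 x v, H.sq_eq 1 x v, H.sq_eq 2 x v⟩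
  · rintro ⟨ω₁, ω₂, ω₃, ⟨n₁, n₂, n₃⟩, -, hsq, c₁, c₂, c₃⟩
    exact IsSymplecticTriple.isHyperkahler
      ⟨n₁, n₂, n₃, TwoForm.isSmooth_invComp n₃ ω₂, TwoForm.isSmooth_invComp n₁ ω₃,
        TwoForm.isSmooth_invComp n₂ ω₁, fun x v ↦ (hsq x v).1, fun x v ↦ (hsq x v).2.1,
        fun x v ↦ (hsq x v).2.2, invComp_spec n₃, invComp_spec n₁, invComp_spec n₂⟩ c₁ c₂ c₃
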